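/- For $k\ge 0$ let $H^2_{\mathbb C^k}(\mathbb D)$ be the Hardy space of functions $F(z)=\sum_{n\ge 0}A_nz^n$, $A_n\in\mathbb C^k$, with $\|F\|^2=\sum_n\|A_n\|^2<\infty$; let $S$ be the shift $(SF)(z)=zF(z)$ and $S^*$ its adjoint. A closed subspace $\mathcal M\subseteq H^2_{\mathbb C^m}(\mathbb D)$ is nearly $S^*$-invariant if $S^*F\in\mathcal M$ for every $F\in\mathcal M$ with $F(0)=0$. It is almost invariant for $S$ if $S\mathcal M\subseteq\mathcal M+\mathcal F$ for some finite-dimensional subspace $\mathcal F\subseteq H^2_{\mathbb C^m}(\mathbb D)$; the smallest possible dimension of such an $\mathcal F$ is the defect of $\mathcal M$. It is a half-space if it has infinite dimension and infinite codimension. An inner multiplier from $\mathbb C^{s}$ to $\mathbb C^r$ is a bounded analytic function $\Theta:\mathbb D\to\mathcal L(\mathbb C^{s},\mathbb C^r)$ for which $G\mapsto\Theta G$ is an isometry from $H^2_{\mathbb C^{s}}(\mathbb D)$ to $H^2_{\mathbb C^r}(\mathbb D)$, and $\mathcal K_\Theta=H^2_{\mathbb C^r}(\mathbb D)\ominus\Theta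 H^2_{\mathbb C^{s}}(\mathbb D)$. Let $\mathcal M\neq\{0\}$ be a nearly $S^*$-invariant closed subspace of $H^2_{\mathbb C^m}(\mathbb D)$, let $W_1,\dots,W_r$ be an orthonormal basis of $\mathcal M\ominus(\mathcal M\cap zH^2_{\mathbb C^m}(\mathbb D))$, and let $F_0$ be the $m\times r$ matrix function with columns $W_1,\dots,W_r$. (1) If $\Theta$ is an inner multiplier from $\mathbb C^{r'}$ to $\mathbb C^r$ with $\Theta(0)=0$ and $\mathcal M=F_0\mathcal K_\Theta=\{F_0G: G\in\mathcal K_\Theta\}$, then $\mathcal M$ is almost invariant for $S$ with defect $r'$. (2) If moreover $r'=r$ and $\Theta=\operatorname{diag}(\theta_1,\dots,\theta_r)$ with scalar inner functions $\theta_i$ (bounded holomorphic functions on $\mathbb D$ with radial limits of modulus $1$ almost everywhere on the unit circle), at least one of which is not rational, i.e. not a finite Blaschke product (unimodular constants counting as finite Blaschke products), then $\mathcal M$ is a half-space that is almost invariant for $S$ with defect $r$. -/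

import Mathlib

open Filter Topology MeasureTheory Metric
open scoped ComplexConjugate Matrix

noncomputable section

/-- The `ℂᵐ`-valued Hardy space `H²` of the disc: the square-summable sequences `(Aₙ)` of Taylor
coefficients of `F(z) = ∑ Aₙ zⁿ`, with `‖F‖² = ∑ ‖Aₙ‖²`. -/
abbrev Hardy (m : ℕ) : Type := lp (fun _ : ℕ => EuclideanSpace ℂ (Fin m)) 2

namespace Hardy

variable {m r : ℕ}

/-- The value `F(z) = ∑ Aₙ zⁿ` (meaningful for `|z| < 1`). -/
def eval (F : Hardy m) (z : ℂ) : EuclideanSpace ℂ (Fin m) := ∑' n : ℕ, z ^ n • F n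

theorem summable_eval (F : Hardy m) {z : ℂ} (hz : z ∈ ball (0 : ℂ) 1) :
    Summable fun n : ℕ => z ^ n • F n := by
  have hz' : ‖z‖ < 1 := by simpa using hz
  refine Summable.of_norm_bounded (g := fun n : ℕ => ‖z‖ ^ n * ‖F‖)
    ((summable_geometric_of_lt_one (norm_nonneg z) hz').mul_right _) fun n => ?_
  rw [norm_smul, norm_pow]
  exact mul_le_mul_of_nonneg_left (lp.norm_apply_le_norm (by norm_num) F n) (by positivity)

theorem eval_add (F G : Hardy m) {z : ℂ} (hz : z ∈ ball (0 : ℂ) 1) :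
    eval (F + G) z = eval F z + eval G z := by
  unfold eval
  rw [← (summable_eval F hz).tsum_add (summable_eval G hz)]
  simp [smul_add]

theorem eval_smul (c : ℂ) (F : Hardy m) {z : ℂ} (hz : z ∈ ball (0 : ℂ) 1) :
    eval (c • F) z = c • eval F z := by
  unfold eval
  rw [← (summable_eval F hz).tsum_const_smul c]
  simp [smul_comm c]

@[simp] theorem eval_zero_function (z : ℂ) : eval (0 : Hardy m) z = 0 := by
  simp [eval]

/-- The coefficients `0, A₀, A₁, …` of `z F(z)`. -/
def shiftCoeff (F : ℕ → EuclideanSpace ℂ (Fin m)) : ℕ → EuclideanSpace ℂ (Fin m)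
  | 0 => 0
  | n + 1 => F n

theorem hasSum_shiftCoeff (F : Hardy m) :
    HasSum (fun n => ‖shiftCoeff F n‖ ^ (2 : ENNReal).toReal)
      (‖F‖ ^ (2 : ENNReal).toReal) := by
  have h := lp.hasSum_norm (p := 2) (by norm_num) F
  rw [← hasSum_nat_add_iff' 1]
  simpa [shiftCoeff] using h

theorem memlp_shiftCoeff (F : Hardy m) : Memℓp (shiftCoeff F) 2 :=
  memℓp_gen (hasSum_shiftCoeff F).summable

/-- The forward shift as a linear isometry. -/
def shiftIsometry (m : ℕ) : Hardy m →ₗᵢ[ℂ] Hardy m where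
  toFun F := ⟨shiftCoeff F, memlp_shiftCoeff F⟩
  map_add' F G := by
    ext1
    funext n
    change shiftCoeff (F + G : Hardy m) n = shiftCoeff F n + shiftCoeff G n
    cases n <;> simp [shiftCoeff]
  map_smul' c F := by
    ext1
    funext n
    cases n <;> simp [shiftCoeff]
  norm_map' F := by
    have h := lp.hasSum_norm (p := 2) (by norm_num)
      (⟨shiftCoeff F, memlp_shiftCoeff F⟩ : Hardy m)
    have h2 := h.unique (hasSum_shiftCoeff F)
    have h3 : (0 : ℝ) < (2 : ENNReal).toReal := by norm_num
    exact (Real.rpow_left_inj (norm_nonneg _) (norm_nonneg _) h3.ne').1 h2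

/-- The forward shift `S` on `H²`. -/
def shift (m : ℕ) : Hardy m →L[ℂ] Hardy m := (shiftIsometry m).toContinuousLinearMap

/-- `S` is multiplication by the independent variable. -/
theorem eval_shift (F : Hardy m) {z : ℂ} (hz : z ∈ ball (0 : ℂ) 1) :
    eval (shift m F) z = z • eval F z := by
  unfold eval
  rw [(summable_eval (shift m F) hz).tsum_eq_zero_add, ← (summable_eval F hz).tsum_const_smul z]
  have h0 : (shift m F) 0 = 0 := rfl
  have hs : ∀ n, (shift m F) (n + 1) = F n := fun _ => rfl
  simp [h0, hs, pow_succ', mul_smul]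

/-- The backward shift `S*`, the adjoint of `S`. -/
def backwardShift (m : ℕ) : Hardy m →L[ℂ] Hardy m := ContinuousLinearMap.adjoint (shift m)

/-- Near invariance for the backward shift (of a subspace that is closed). -/
def IsNearlyInvariant (M : Submodule ℂ (Hardy m)) : Prop :=
  IsClosed (M : Set (Hardy m)) ∧ ∀ F ∈ M, eval F 0 = 0 → backwardShift m F ∈ M

/-- The space `M ⊖ (M ∩ z H²)`. -/
def wandering (M : Submodule ℂ (Hardy m)) : Submodule ℂ (Hardy m) :=
  M ⊓ (M ⊓ (shift m).range)ᗮ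

/-- The `m × r` matrix function on the disc whose columns are `W₁, …, W_r`. -/
def columnMatrix (W : Fin r → Hardy m) (z : ℂ) : Matrix (Fin m) (Fin r) ℂ :=
  Matrix.of fun i j => eval (W j) z i

/-- `M = F₀ K`, as an equality of sets of functions on the disc. -/
def EqMatrixMul (M : Submodule ℂ (Hardy m)) (F₀ : ℂ → Matrix (Fin m) (Fin r) ℂ)
    (K : Submodule ℂ (Hardy r)) : Prop :=
  (∀ G ∈ K, ∃ F ∈ M, ∀ z ∈ ball (0 : ℂ) 1, (eval F z).ofLp = F₀ z *ᵥ (eval G z).ofLp) ∧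
  (∀ F ∈ M, ∃ G ∈ K, ∀ z ∈ ball (0 : ℂ) 1, (eval F z).ofLp = F₀ z *ᵥ (eval G z).ofLp)

/-- `Θ` is a bounded analytic function on the disc with values in `L(ℂˢ, ℂʳ)` such that
multiplication by `Θ` is an isometry from `H²` of `ℂˢ` to `H²` of `ℂʳ`. Only the values of `Θ`
on the disc matter. -/
structure IsInnerMultiplier {s r : ℕ}
    (Θ : ℂ → EuclideanSpace ℂ (Fin s) →L[ℂ] EuclideanSpace ℂ (Fin r)) : Prop where
  analytic : DifferentiableOn ℂ Θ (ball 0 1)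
  bounded : ∃ C : ℝ, ∀ z ∈ ball (0 : ℂ) 1, ‖Θ z‖ ≤ C
  isometry : ∀ G : Hardy s, ∃ F : Hardy r,
    (∀ z ∈ ball (0 : ℂ) 1, eval F z = Θ z (eval G z)) ∧ ‖F‖ = ‖G‖

/-- The space `Θ H²`. -/
def multiplierRange {s r : ℕ}
    (Θ : ℂ → EuclideanSpace ℂ (Fin s) →L[ℂ] EuclideanSpace ℂ (Fin r)) :
    Submodule ℂ (Hardy r) where
  carrier := {F | ∃ G : Hardy s, ∀ z ∈ ball (0 : ℂ) 1, eval F z = Θ z (eval G z)}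
  add_mem' := by
    rintro F₁ F₂ ⟨G₁, h₁⟩ ⟨G₂, h₂⟩
    exact ⟨G₁ + G₂, fun z hz => by
      rw [eval_add _ _ hz, eval_add _ _ hz, map_add, h₁ z hz, h₂ z hz]⟩
  zero_mem' := ⟨0, fun z _ => by simp⟩
  smul_mem' := by
    rintro c F ⟨G, h⟩
    exact ⟨c • G, fun z hz => by rw [eval_smul _ _ hz, eval_smul _ _ hz, map_smul, h z hz]⟩

/-- The model space `K_Θ = H² ⊖ Θ H²`. -/
def modelSpace {s r : ℕ}
    (Θ : ℂ → EuclideanSpace ℂ (Fin s) →L[ℂ] EuclideanSpace ℂ (Fin r)) :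
    Submodule ℂ (Hardy r) := (multiplierRange Θ)ᗮ

end Hardy

/-- Scalar inner functions: bounded and holomorphic on the disc, with radial limits of modulus one
at almost every point of the unit circle. -/
structure IsInnerFunction (θ : ℂ → ℂ) : Prop where
  holomorphic : DifferentiableOn ℂ θ (ball 0 1)
  bounded : ∃ C : ℝ, ∀ z ∈ ball (0 : ℂ) 1, ‖θ z‖ ≤ C
  unimodular : ∀ᵐ t : ℝ ∂volume, ∃ l : ℂ, ‖l‖ = 1 ∧
    Tendsto (fun ρ : ℝ => θ (ρ * Complex.exp (t * Complex.I))) (𝓝[<] 1) (𝓝 l)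

/-- Finite Blaschke products (unimodular constants included): the rational inner functions. -/
def IsFiniteBlaschkeProduct (θ : ℂ → ℂ) : Prop :=
  ∃ (c : ℂ) (n : ℕ) (a : Fin n → ℂ), ‖c‖ = 1 ∧ (∀ k, ‖a k‖ < 1) ∧
    ∀ z ∈ ball (0 : ℂ) 1, θ z = c * ∏ k, (z - a k) / (1 - conj (a k) * z)

section AlmostInvariant

variable {E : Type*} [NormedAddCommGroup E] [NormedSpace ℂ E]

/-- `F` is a finite-dimensional space with `T M ⊆ M + F`. -/
def IsDefectSpace (T : E →L[ℂ] E) (M F : Submodule ℂ E) : Prop :=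
  FiniteDimensional ℂ F ∧ M.map (T : E →ₗ[ℂ] E) ≤ M ⊔ F

/-- Almost-invariant (closed) subspaces. -/
def IsAlmostInvariant (T : E →L[ℂ] E) (M : Submodule ℂ E) : Prop :=
  IsClosed (M : Set E) ∧ ∃ F : Submodule ℂ E, IsDefectSpace T M F

/-- The defect of `M` is `d`: the smallest dimension of a finite-dimensional `F` with
`T M ⊆ M + F`. -/
def HasDefect (T : E →L[ℂ] E) (M : Submodule ℂ E) (d : ℕ) : Prop :=
  IsLeast {n : ℕ | ∃ F : Submodule ℂ E, IsDefectSpace T M F ∧ Module.finrank ℂ F = n} d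

/-- Half-spaces: infinite dimension and infinite codimension. -/
def IsHalfSpace (M : Submodule ℂ E) : Prop :=
  ¬ FiniteDimensional ℂ M ∧ ¬ FiniteDimensional ℂ (E ⧸ M)

end AlmostInvariant

end

/-! ### Shifts, coefficients and point evaluations -/

namespace Hardy

variable {m r s : ℕ}

/-! Defect. `F₀(0)` is injective, because a wandering vector vanishing at `0` lies in `M ∩ zH²` and
is therefore orthogonal to itself (`columnMatrix_zero_injective`). Stripping powers of `z` then
makes multiplication by `F₀` injective on all of `H²` (`eq_zero_of_mulVec_eval_eq_zero`), so
questions about `M = F₀ K_Θ` become questions about `K_Θ`. For `G ∈ K_Θ`, the component of `zG` in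
`ΘH²` is `Θc` with `c` constant, since `S*` annihilates its preimage; hence `SM ⊆ M + F₀Θℂˢ`.
Conversely `Θ(0) = 0` gives `Θc = z S*(Θc)` with `S*(Θc) ∈ K_Θ`, so `F₀Θℂˢ ⊆ SM`; this space has
dimension `s` and meets `M` trivially, so no smaller defect space exists (`exists_defect_linearMap`,
`finrank_le_of_injective_of_le_sup`).

Infinite codimension. Near invariance says `S⁻¹M ⊆ M`. In finite codimension a dimension count
forces equality (`Submodule.le_comap_of_comap_le`), so `SM ⊆ M` and the defect is `0`, not `r > 0`.

Infinite dimension. If `M` were finite-dimensional, so would be `K_Θ` and, coordinate by coordinate,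
the cokernel of multiplication by each `θ_j`. Such a cokernel is `S*`-invariant; an eigenvector of
`S*` in it is a Szegő kernel and exhibits a zero of `θ_j`. Dividing out the Blaschke factor lowers
the dimension, and induction shows that `θ_j` is a finite Blaschke product
(`exists_blaschke_of_finiteDimensional`). -/

@[simp] theorem shift_apply_zero (F : Hardy m) : shift m F 0 = 0 := rfl

@[simp] theorem shift_apply_succ (F : Hardy m) (n : ℕ) : shift m F (n + 1) = F n := rfl

theorem inner_shift_shift (F G : Hardy m) : inner ℂ (shift m F) (shift m G) = inner ℂ F G :=
  (shiftIsometry m).inner_map_map F G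

theorem norm_shift_apply (F : Hardy m) : ‖shift m F‖ = ‖F‖ := (shiftIsometry m).norm_map F

theorem inner_single_left (n : ℕ) (v : EuclideanSpace ℂ (Fin m)) (F : Hardy m) :
    inner ℂ (lp.single 2 n v : Hardy m) F = inner ℂ v (F n) := by
  have h := lp.inner_single_left (𝕜 := ℂ) n v F
  exact h

theorem shift_single (n : ℕ) (v : EuclideanSpace ℂ (Fin m)) :
    shift m (lp.single 2 n v) = lp.single 2 (n + 1) v := by
  ext1
  funext k
  cases k with
  | zero => simp
  | succ k => rw [shift_apply_succ]; simp [Pi.single_apply]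

@[simp] theorem backwardShift_apply (F : Hardy m) (n : ℕ) :
    backwardShift m F n = F (n + 1) := by
  refine ext_inner_left ℂ fun v : EuclideanSpace ℂ (Fin m) => ?_
  have h := ContinuousLinearMap.adjoint_inner_right (shift m) (lp.single 2 n v) F
  rw [shift_single] at h
  rwa [← backwardShift, inner_single_left, inner_single_left] at h

@[simp] theorem backwardShift_shift (F : Hardy m) : backwardShift m (shift m F) = F := by
  ext1
  funext n
  simp

theorem shift_backwardShift_of_apply_zero {F : Hardy m} (h : F 0 = 0) :
    shift m (backwardShift m F) = F := by
  ext1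
  funext n
  cases n <;> simp [h]

@[simp] theorem eval_zero_point (F : Hardy m) : eval F 0 = F 0 := by
  unfold eval
  rw [tsum_eq_single 0 fun n hn => by simp [hn]]
  simp

theorem eval_sub (F G : Hardy m) {z : ℂ} (hz : z ∈ ball (0 : ℂ) 1) :
    eval (F - G) z = eval F z - eval G z := by
  rw [sub_eq_add_neg, ← neg_one_smul ℂ G, eval_add _ _ hz, eval_smul _ _ hz, neg_one_smul,
    sub_eq_add_neg]

theorem eval_sum {ι : Type*} (t : Finset ι) (F : ι → Hardy m) {z : ℂ} (hz : z ∈ ball (0 : ℂ) 1) :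
    eval (∑ i ∈ t, F i) z = ∑ i ∈ t, eval (F i) z := by
  classical
  induction t using Finset.induction_on with
  | empty => simp
  | insert i t hi ih => rw [Finset.sum_insert hi, Finset.sum_insert hi, eval_add _ _ hz, ih]

theorem continuousAt_eval (F : Hardy m) : ContinuousAt (eval F) 0 := by
  refine ContinuousOn.continuousAt (s := closedBall (0 : ℂ) 2⁻¹) ?_
    (closedBall_mem_nhds _ (by norm_num))
  refine continuousOn_tsum (u := fun n => (2⁻¹ : ℝ) ^ n * ‖F‖) (fun n => by fun_prop)
    ((summable_geometric_of_lt_one (by norm_num) (by norm_num)).mul_right _) fun n z hz => ?_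
  rw [norm_smul, norm_pow]
  have : ‖z‖ ≤ 2⁻¹ := by simpa using hz
  gcongr
  exact lp.norm_apply_le_norm (by norm_num) F n

/-- The constant functions. -/
noncomputable def constant (m : ℕ) : EuclideanSpace ℂ (Fin m) →ₗ[ℂ] Hardy m where
  toFun v := lp.single 2 0 v
  map_add' v w := by
    have h := lp.single_add (E := fun _ : ℕ => EuclideanSpace ℂ (Fin m)) 2 0 v w
    exact h
  map_smul' c v := by
    have h := lp.single_smul (E := fun _ : ℕ => EuclideanSpace ℂ (Fin m)) 2 0 c v
    exact h

@[simp] theorem constant_apply_zero (v : EuclideanSpace ℂ (Fin m)) : constant m v 0 = v := by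
  simp [constant]

@[simp] theorem constant_apply_succ (v : EuclideanSpace ℂ (Fin m)) (n : ℕ) :
    constant m v (n + 1) = 0 := by
  simp [constant]

theorem inner_constant_left (v : EuclideanSpace ℂ (Fin m)) (F : Hardy m) :
    inner ℂ (constant m v) F = inner ℂ v (F 0) := inner_single_left 0 v F

theorem norm_constant (v : EuclideanSpace ℂ (Fin m)) : ‖constant m v‖ = ‖v‖ :=
  lp.norm_single (p := 2) (E := fun _ : ℕ => EuclideanSpace ℂ (Fin m)) (by norm_num) 0 v

theorem constant_of_backwardShift_eq_zero {F : Hardy m} (h : backwardShift m F = 0) :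
    constant m (F 0) = F := by
  ext1
  funext n
  cases n with
  | zero => simp
  | succ n => rw [constant_apply_succ, ← backwardShift_apply, h]; rfl

/-! ### Injectivity of matrix multiplication; isometric multipliers -/

/-- Multiplication by a matrix function that is injective at the origin is injective. -/
theorem eq_zero_of_mulVec_eval_eq_zero {A : ℂ → Matrix (Fin m) (Fin r) ℂ} (hA : ContinuousAt A 0)
    (hinj : ∀ v, A 0 *ᵥ v = 0 → v = 0) {G : Hardy r}
    (h : ∀ z ∈ ball (0 : ℂ) 1, A z *ᵥ (eval G z).ofLp = 0) : G = 0 := by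
  -- Quantifying over `G` inside the induction lets the hypothesis pass to `S*G`, whose `n`-th
  -- coefficient is the next one of `G`.
  have key : ∀ n : ℕ, ∀ G : Hardy r,
      (∀ z ∈ ball (0 : ℂ) 1, A z *ᵥ (eval G z).ofLp = 0) → G n = 0 := by
    intro n
    have h0 : ∀ G : Hardy r, (∀ z ∈ ball (0 : ℂ) 1, A z *ᵥ (eval G z).ofLp = 0) → G 0 = 0 := by
      intro G h
      have := hinj _ (h 0 (by simp))
      rw [eval_zero_point] at this
      exact (WithLp.ofLp_eq_zero 2).1 this
    induction n with
    | zero => exact h0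
    | succ n ih =>
      intro G h
      rw [← backwardShift_apply]
      refine ih _ fun z hz => ?_
      have hne : ∀ z ∈ ball (0 : ℂ) 1, z ≠ 0 → A z *ᵥ (eval (backwardShift r G) z).ofLp = 0 := by
        intro z hz hz0
        have h1 := h z hz
        rw [← shift_backwardShift_of_apply_zero (h0 G h), eval_shift _ hz, WithLp.ofLp_smul,
          Matrix.mulVec_smul] at h1
        exact (smul_eq_zero.1 h1).resolve_left hz0
      rcases eq_or_ne z 0 with rfl | hz0
      -- Dividing `zA(z)(S*G)(z) = 0` by `z` loses the origin, which is recovered by continuity.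
      · have hcont : ContinuousAt (fun z => A z *ᵥ (eval (backwardShift r G) z).ofLp) 0 :=
          ContinuousAt.comp (g := fun p : Matrix (Fin m) (Fin r) ℂ ×
            EuclideanSpace ℂ (Fin r) => p.1 *ᵥ p.2.ofLp)
            (Continuous.matrix_mulVec continuous_fst
              ((PiLp.continuous_ofLp 2 _).comp continuous_snd)).continuousAt
            (hA.prodMk (continuousAt_eval _))
        refine tendsto_nhds_unique (hcont.tendsto.mono_left (nhdsWithin_le_nhds (s := {0}ᶜ))) ?_
        refine tendsto_const_nhds.congr' ?_
        filter_upwards [self_mem_nhdsWithin,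
          nhdsWithin_le_nhds (ball_mem_nhds (0 : ℂ) one_pos)] with z hz0 hz
        exact (hne z hz hz0).symm
      · exact hne z hz hz0
  ext1
  funext n
  exact key n G h

theorem eval_ext {F G : Hardy m} (h : ∀ z ∈ ball (0 : ℂ) 1, eval F z = eval G z) : F = G := by
  refine sub_eq_zero.1 (eq_zero_of_mulVec_eval_eq_zero (A := fun _ => 1) continuousAt_const
    (fun v hv => by rwa [Matrix.one_mulVec] at hv) fun z hz => ?_)
  simp [eval_sub _ _ hz, h z hz]

/-- An isometric multiplier induces a linear isometry. -/
theorem exists_multiplier_isometry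
    {Θ : ℂ → EuclideanSpace ℂ (Fin s) →L[ℂ] EuclideanSpace ℂ (Fin r)}
    (h : ∀ G : Hardy s, ∃ F : Hardy r,
      (∀ z ∈ ball (0 : ℂ) 1, eval F z = Θ z (eval G z)) ∧ ‖F‖ = ‖G‖) :
    ∃ T : Hardy s →ₗᵢ[ℂ] Hardy r, ∀ G, ∀ z ∈ ball (0 : ℂ) 1, eval (T G) z = Θ z (eval G z) := by
  choose T hT hn using h
  refine ⟨{ toFun := T, map_add' := fun F G => eval_ext fun z hz => ?_,
            map_smul' := fun c F => eval_ext fun z hz => ?_, norm_map' := hn }, hT⟩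
  · rw [eval_add _ _ hz, hT _ z hz, hT _ z hz, hT _ z hz, eval_add _ _ hz, map_add]
  · rw [RingHom.id_apply, eval_smul _ _ hz, hT _ z hz, hT _ z hz, eval_smul _ _ hz, map_smul]

theorem map_shift_of_eval_eq
    {Θ : ℂ → EuclideanSpace ℂ (Fin s) →L[ℂ] EuclideanSpace ℂ (Fin r)}
    {T : Hardy s →ₗᵢ[ℂ] Hardy r}
    (hT : ∀ G, ∀ z ∈ ball (0 : ℂ) 1, eval (T G) z = Θ z (eval G z)) (G : Hardy s) :
    T (shift s G) = shift r (T G) :=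
  eval_ext fun z hz => by
    rw [hT _ z hz, eval_shift _ hz, eval_shift _ hz, map_smul, hT _ z hz]

theorem multiplierRange_eq_range
    {Θ : ℂ → EuclideanSpace ℂ (Fin s) →L[ℂ] EuclideanSpace ℂ (Fin r)}
    {T : Hardy s →ₗᵢ[ℂ] Hardy r}
    (hT : ∀ G, ∀ z ∈ ball (0 : ℂ) 1, eval (T G) z = Θ z (eval G z)) :
    multiplierRange Θ = LinearMap.range T.toLinearMap := by
  ext F
  constructor
  · rintro ⟨G, hG⟩
    exact ⟨G, eval_ext fun z hz => (hT G z hz).trans (hG z hz).symm⟩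
  · rintro ⟨G, rfl⟩
    exact ⟨G, hT G⟩

theorem continuousAt_columnMatrix (W : Fin r → Hardy m) : ContinuousAt (columnMatrix W) 0 :=
  continuousAt_pi.2 fun i => continuousAt_pi.2 fun j =>
    (EuclideanSpace.proj (𝕜 := ℂ) i).continuous.continuousAt.comp (continuousAt_eval (W j))

/-- A combination of the `W_j` that vanishes at `0` lies in `M ∩ zH²`, to which wandering vectors
are orthogonal. It is thus orthogonal to itself, and the `W_j` are independent. -/
theorem columnMatrix_zero_injective {M : Submodule ℂ (Hardy m)}
    (W : OrthonormalBasis (Fin r) ℂ (wandering M)) (v : Fin r → ℂ)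
    (hv : columnMatrix (fun j => (W j : Hardy m)) 0 *ᵥ v = 0) : v = 0 := by
  set w : wandering M := ∑ j, v j • W j with hw
  have hcoe : (w : Hardy m) = ∑ j, v j • (W j : Hardy m) := by simp [hw]
  have h0 : (w : Hardy m) 0 = 0 := by
    rw [← eval_zero_point, hcoe, eval_sum _ _ (mem_ball_self one_pos)]
    ext i
    have := congr_fun hv i
    rw [Matrix.mulVec, dotProduct] at this
    simp only [columnMatrix, Matrix.of_apply, Pi.zero_apply] at this
    refine Eq.trans ?_ this
    rw [WithLp.ofLp_sum, Finset.sum_apply]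
    refine Finset.sum_congr rfl fun j _ => ?_
    rw [eval_smul _ _ (mem_ball_self one_pos), PiLp.smul_apply, smul_eq_mul, mul_comm]
  have hmem : (w : Hardy m) ∈ M ⊓ (shift m).range :=
    ⟨w.2.1, ⟨_, shift_backwardShift_of_apply_zero h0⟩⟩
  have hw0 : w = 0 := Subtype.ext (inner_self_eq_zero.1 (w.2.2 _ hmem))
  funext j
  exact Fintype.linearIndependent_iff.1 W.orthonormal.linearIndependent v (hw ▸ hw0) j

theorem eval_eq_add_smul_eval_backwardShift (F : Hardy m) {z : ℂ} (hz : z ∈ ball (0 : ℂ) 1) :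
    eval F z = F 0 + z • eval (backwardShift m F) z := by
  unfold eval
  rw [(summable_eval F hz).tsum_eq_zero_add,
    ← (summable_eval (backwardShift m F) hz).tsum_const_smul z]
  simp [pow_succ', mul_smul]

/-! ### Blaschke factors -/

theorem norm_shift_le : ‖shift m‖ ≤ 1 :=
  ContinuousLinearMap.opNorm_le_bound _ zero_le_one fun F => by rw [norm_shift_apply, one_mul]

theorem norm_backwardShift_le : ‖backwardShift m‖ ≤ 1 :=
  (ContinuousLinearMap.adjoint.norm_map (shift m)).trans_le norm_shift_le

theorem isUnit_one_sub_smul {T : Hardy m →L[ℂ] Hardy m} (hT : ‖T‖ ≤ 1) {a : ℂ} (ha : ‖a‖ < 1) :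
    IsUnit (1 - a • T) := by
  refine isUnit_one_sub_of_norm_lt_one ?_
  rw [norm_smul]
  exact (mul_le_of_le_one_right (norm_nonneg a) hT).trans_lt ha

/-- Solve `H - a S*H = F` by a Neumann series. Evaluating at `a` gives `F(a) = H(0)`, so `H(0) = 0`,
`H = S S*H`, and `Q = S*H` works. -/
theorem exists_shift_sub_smul_eq {F : Hardy m} {a : ℂ} (ha : ‖a‖ < 1) (hF : eval F a = 0) :
    ∃ Q, shift m Q - a • Q = F := by
  have ha' : a ∈ ball (0 : ℂ) 1 := by simpa using ha
  obtain ⟨u, hu⟩ := isUnit_one_sub_smul (norm_backwardShift_le (m := m)) ha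
  set H : Hardy m := u⁻¹.1 F with hH
  have hHF : H - a • backwardShift m H = F := by
    have h : (u.1 * u⁻¹.1) F = F := by rw [u.mul_inv]; rfl
    rw [hu] at h
    exact h
  have h0 : H 0 = 0 := by
    rw [← hHF, eval_sub _ _ ha', eval_smul _ _ ha',
      eval_eq_add_smul_eval_backwardShift H ha', add_sub_cancel_right] at hF
    exact hF
  exact ⟨backwardShift m H, by rw [shift_backwardShift_of_apply_zero h0, hHF]⟩

/-- The operator form of `|z - a| = |1 - ā z|` on the circle: it needs only that `S` is isometric,
and no boundary values. -/
theorem norm_shift_sub_smul (a : ℂ) (G : Hardy m) :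
    ‖shift m G - a • G‖ = ‖G - conj a • shift m G‖ := by
  refine (sq_eq_sq₀ (norm_nonneg _) (norm_nonneg _)).1 ?_
  have h : RCLike.re (a * inner ℂ (shift m G) G) = RCLike.re (conj a * inner ℂ G (shift m G)) := by
    rw [← RCLike.conj_re (conj a * inner ℂ G (shift m G)), map_mul (starRingEnd ℂ), RCLike.conj_conj,
      inner_conj_symm]
  rw [norm_sub_sq (𝕜 := ℂ), norm_sub_sq (𝕜 := ℂ), norm_smul, norm_smul, norm_shift_apply,
    RCLike.norm_conj, inner_smul_right, inner_smul_right, h]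

/-- Multiplication by a Blaschke factor is an isometry, onto the functions vanishing at its
zero. -/
theorem exists_blaschkeFactor_isometry (m : ℕ) {a : ℂ} (ha : ‖a‖ < 1) :
    ∃ B : Hardy m →ₗᵢ[ℂ] Hardy m,
      (∀ G, ∀ z ∈ ball (0 : ℂ) 1, eval (B G) z = ((z - a) / (1 - conj a * z)) • eval G z) ∧
      ∀ F, eval F a = 0 → ∃ G, B G = F := by
  obtain ⟨u, hu⟩ := isUnit_one_sub_smul (norm_shift_le (m := m)) (a := conj a)
    (by rwa [RCLike.norm_conj])
  have hu1 : ∀ F : Hardy m, u⁻¹.1 F - conj a • shift m (u⁻¹.1 F) = F := by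
    intro F
    have h : (u.1 * u⁻¹.1) F = F := by rw [u.mul_inv]; rfl
    rw [hu] at h
    exact h
  have hu2 : ∀ F : Hardy m, u⁻¹.1 (F - conj a • shift m F) = F := by
    intro F
    have h : (u⁻¹.1 * u.1) F = F := by rw [u.inv_mul]; rfl
    rw [hu] at h
    exact h
  -- The Blaschke multiplier is `(S - a)(1 - āS)⁻¹`.
  refine ⟨⟨((shift m - a • 1) * u⁻¹.1 : Hardy m →L[ℂ] Hardy m), fun F => ?_⟩,
    fun G z hz => ?_, fun F hF => ?_⟩
  · change ‖shift m (u⁻¹.1 F) - a • u⁻¹.1 F‖ = ‖F‖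
    rw [norm_shift_sub_smul, hu1]
  · change eval (shift m (u⁻¹.1 G) - a • u⁻¹.1 G) z = _
    have hne : 1 - conj a * z ≠ 0 := by
      intro h
      have h1 : ‖conj a * z‖ = 1 := by rw [← sub_eq_zero.1 h, norm_one]
      have hz' : ‖z‖ < 1 := by simpa using hz
      rw [norm_mul, RCLike.norm_conj] at h1
      nlinarith [norm_nonneg a, norm_nonneg z]
    conv_rhs => rw [← hu1 G]
    rw [eval_sub _ _ hz, eval_sub _ _ hz, eval_smul _ _ hz, eval_smul _ _ hz, eval_shift _ hz,
      ← sub_smul, smul_smul, ← one_smul ℂ (eval (u⁻¹.1 G) z), smul_smul, smul_smul, ← sub_smul,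
      smul_smul, mul_one, mul_one, div_mul_cancel₀ _ hne]
  · obtain ⟨Q, rfl⟩ := exists_shift_sub_smul_eq ha hF
    refine ⟨Q - conj a • shift m Q, ?_⟩
    change shift m (u⁻¹.1 (Q - conj a • shift m Q)) - a • u⁻¹.1 (Q - conj a • shift m Q) = _
    rw [hu2]

/-! ### Eigenvectors of the backward shift and finite Blaschke products -/

theorem apply_eq_pow_smul_of_backwardShift_eq {k : Hardy m} {μ : ℂ} (hk : backwardShift m k = μ • k)
    (n : ℕ) : k n = μ ^ n • k 0 := by
  induction n with
  | zero => simp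
  | succ n ih => rw [← backwardShift_apply, hk, lp.coeFn_smul, Pi.smul_apply, ih, smul_smul,
      pow_succ']

theorem apply_zero_ne_zero_of_backwardShift_eq {k : Hardy m} {μ : ℂ} (hk : backwardShift m k = μ • k)
    (h0 : k ≠ 0) : k 0 ≠ 0 := by
  intro h
  refine h0 ?_
  ext1
  funext n
  rw [apply_eq_pow_smul_of_backwardShift_eq hk n, h, smul_zero]
  rfl

/-- The coefficients form a geometric sequence with ratio `μ`, which is square-summable only for
`‖μ‖ < 1`. -/
theorem norm_lt_one_of_backwardShift_eq {k : Hardy m} {μ : ℂ} (hk : backwardShift m k = μ • k)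
    (h0 : k ≠ 0) : ‖μ‖ < 1 := by
  have h := (lp.hasSum_norm (p := 2) (by norm_num) k).summable
  have hk0 := apply_zero_ne_zero_of_backwardShift_eq hk h0
  by_contra! hμ
  have h1 := (h.tendsto_atTop_zero).eventually (gt_mem_nhds
    (Real.rpow_pos_of_pos (norm_pos_iff.2 hk0) (2 : ENNReal).toReal))
  obtain ⟨n, hn⟩ := h1.exists
  rw [apply_eq_pow_smul_of_backwardShift_eq hk n, norm_smul, norm_pow] at hn
  refine hn.not_ge (Real.rpow_le_rpow (norm_nonneg _) ?_ (by norm_num))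
  exact le_mul_of_one_le_left (norm_nonneg _) (one_le_pow₀ hμ)

/-- The reproducing property: an eigenvector with eigenvalue `μ` is the Szegő kernel at `conj μ` in
the direction `k 0`. -/
theorem inner_eq_of_backwardShift_eq {k : Hardy m} {μ : ℂ} (hk : backwardShift m k = μ • k)
    (h0 : k ≠ 0) (F : Hardy m) :
    inner ℂ k F = inner ℂ (k 0) (eval F (conj μ)) := by
  have hμ : conj μ ∈ ball (0 : ℂ) 1 := by
    simpa using norm_lt_one_of_backwardShift_eq hk h0
  have hcoeff : (fun n => inner ℂ (k n) (F n)) =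
      fun n => innerSL ℂ (k 0) (conj μ ^ n • F n) := by
    funext n
    rw [apply_eq_pow_smul_of_backwardShift_eq hk n, innerSL_apply_apply, inner_smul_left,
      inner_smul_right, map_pow]
  refine (lp.hasSum_inner k F).unique ?_
  rw [hcoeff]
  exact (innerSL ℂ (k 0)).hasSum (summable_eval F hμ).hasSum

/-- An isometry of the scalar Hardy space that commutes with the shift and has finite-dimensional
cokernel maps `1` to a finite Blaschke product. -/
theorem exists_blaschke_of_finiteDimensional (T : Hardy 1 →ₗᵢ[ℂ] Hardy 1)
    (hT : ∀ G, T (shift 1 G) = shift 1 (T G))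
    (hfin : FiniteDimensional ℂ (LinearMap.range T.toLinearMap)ᗮ) :
    IsFiniteBlaschkeProduct fun z => eval (T (constant 1 (EuclideanSpace.single 0 1))) z 0 := by
  induction hd : Module.finrank ℂ (LinearMap.range T.toLinearMap)ᗮ using Nat.strong_induction_on
    generalizing T with
  | _ d ih =>
  set K := (LinearMap.range T.toLinearMap)ᗮ with hKdef
  set e : Hardy 1 := constant 1 (EuclideanSpace.single 0 1) with he
  have hmem : ∀ {x : Hardy 1}, x ∈ K ↔ ∀ y, inner ℂ x (T y) = 0 := by
    intro x
    rw [hKdef, Submodule.mem_orthogonal']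
    exact ⟨fun h y => h _ ⟨y, rfl⟩, by rintro h _ ⟨y, rfl⟩; exact h y⟩
  by_cases hK : K = ⊥
  -- `S*Te` is always orthogonal to the range of `T`, as `⟨S*Te, Ty⟩ = ⟨e, Sy⟩ = 0`. With no
  -- cokernel, `Te` is therefore a constant, of modulus one.
  · have h1 : backwardShift 1 (T e) = 0 := by
      rw [← Submodule.mem_bot ℂ, ← hK, hmem]
      intro y
      rw [backwardShift, ContinuousLinearMap.adjoint_inner_left, ← hT, T.inner_map_map, he,
        inner_constant_left, shift_apply_zero, inner_zero_right]
    have h3 : ‖T e 0‖ = 1 := by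
      rw [← norm_constant, constant_of_backwardShift_eq_zero h1, T.norm_map, he, norm_constant]
      simp
    refine ⟨T e 0 0, 0, Fin.elim0, ?_, fun k => k.elim0, fun z hz => ?_⟩
    · rw [EuclideanSpace.norm_eq] at h3
      simpa using h3
    · dsimp only
      rw [eval_eq_add_smul_eval_backwardShift _ hz, h1]
      simp
  · have hinv : ∀ x ∈ K, backwardShift 1 x ∈ K := by
      intro x hx
      rw [hmem] at hx ⊢
      intro y
      rw [backwardShift, ContinuousLinearMap.adjoint_inner_left, ← hT, hx]
    have : Nontrivial K := Submodule.nontrivial_iff_ne_bot.2 hK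
    obtain ⟨μ, hμ⟩ := Module.End.exists_eigenvalue
      ((backwardShift 1 : Hardy 1 →ₗ[ℂ] Hardy 1).restrict hinv)
    obtain ⟨k, hk⟩ := hμ.exists_hasEigenvector
    have hk0 : (k : Hardy 1) ≠ 0 := fun h => hk.2 (Subtype.ext h)
    have hkμ : backwardShift 1 (k : Hardy 1) = μ • (k : Hardy 1) :=
      congrArg Subtype.val hk.apply_eq_smul
    have ha : ‖conj μ‖ < 1 := by
      rw [RCLike.norm_conj]; exact norm_lt_one_of_backwardShift_eq hkμ hk0
    obtain ⟨B, hB, hBr⟩ := exists_blaschkeFactor_isometry 1 ha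
    have hrange : ∀ G, ∃ H, B H = T G := by
      intro G
      -- Orthogonality to the kernel `k` means vanishing at `conj μ`, so the Blaschke factor divides
      -- every `T G`.
      refine hBr _ ?_
      have h1 := hmem.1 k.2 G
      rw [inner_eq_of_backwardShift_eq hkμ hk0] at h1
      have h2 := apply_zero_ne_zero_of_backwardShift_eq hkμ hk0
      have h3 : (k : Hardy 1) 0 0 ≠ 0 := by
        intro h
        refine h2 ?_
        ext i
        rw [Subsingleton.elim i 0, h]
        rfl
      ext i
      rw [Subsingleton.elim i 0]
      simp only [PiLp.inner_apply, Fin.sum_univ_one, RCLike.inner_apply, mul_eq_zero] at h1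
      simpa [h3] using h1
    choose f hf using hrange
    let T₁ : Hardy 1 →ₗᵢ[ℂ] Hardy 1 :=
      { toFun := f
        map_add' := fun F G => B.injective (by simp [hf])
        map_smul' := fun c F => B.injective (by simp [hf])
        norm_map' := fun F => by
          rw [← B.norm_map]
          exact (congrArg norm (hf F)).trans (T.norm_map F) }
    have hBT : ∀ G, B (T₁ G) = T G := hf
    have hBS := map_shift_of_eval_eq (T := B)
      (Θ := fun z => ((z - conj μ) / (1 - conj (conj μ) * z)) • 1) (fun G z hz => hB G z hz)
    have hT₁ : ∀ G, T₁ (shift 1 G) = shift 1 (T₁ G) := fun G =>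
      B.injective (by rw [hBT, hT, hBS, hBT])
    set K₁ := (LinearMap.range T₁.toLinearMap)ᗮ with hK₁
    -- The inclusion is strict because `k` is not in the range of `B`: functions there vanish at
    -- `conj μ`, while `k(conj μ) = 0` would give `⟨k, k⟩ = 0`.
    have hlt : K₁.map B.toLinearMap < K := by
      refine lt_of_le_of_ne ?_ fun h => ?_
      · rintro _ ⟨x, hx, rfl⟩
        rw [hmem]
        intro y
        rw [← hBT]
        exact (B.inner_map_map _ _).trans ((Submodule.mem_orthogonal' _ _).1 hx _ ⟨y, rfl⟩)
      · obtain ⟨x, -, hx⟩ : (k : Hardy 1) ∈ K₁.map B.toLinearMap := by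
          rw [h]; exact k.2
        have hx' : B x = k := hx
        have h1 : eval (k : Hardy 1) (conj μ) = 0 := by
          rw [← hx', hB _ _ (by simpa using ha)]
          simp
        refine hk0 (inner_self_eq_zero (𝕜 := ℂ).1 ?_)
        rw [inner_eq_of_backwardShift_eq hkμ hk0, h1, inner_zero_right]
    have hfin' : FiniteDimensional ℂ (K₁.map B.toLinearMap) :=
      Submodule.finiteDimensional_of_le hlt.le
    let φ := Submodule.equivMapOfInjective B.toLinearMap B.injective K₁
    have hfin₁ : FiniteDimensional ℂ K₁ := Module.Finite.equiv φ.symm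
    obtain ⟨c, n, b, hc, hb, hprod⟩ := ih (Module.finrank ℂ K₁)
      (by rw [← hd, φ.finrank_eq]; exact Submodule.finrank_lt_finrank_of_lt hlt) T₁ hT₁ hfin₁ rfl
    refine ⟨c, n + 1, Fin.cons (conj μ) b, hc, fun i => ?_, fun z hz => ?_⟩
    · cases i using Fin.cases with
      | zero => simpa using ha
      | succ i => simpa using hb i
    · simp only [Fin.prod_univ_succ, Fin.cons_zero, Fin.cons_succ]
      rw [mul_left_comm, ← hprod z hz, ← hBT, hB _ _ hz, PiLp.smul_apply, smul_eq_mul]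

end Hardy

/-! ### Dimension counts in quotients -/

section LinearAlgebra

variable {K V W : Type*} [Field K] [AddCommGroup V] [Module K V] [AddCommGroup W] [Module K W]

/-- A space that meets `M` trivially and lies in `M ⊔ F` is no larger than `F`. -/
theorem finrank_le_of_injective_of_le_sup [FiniteDimensional K W] {M F : Submodule K V}
    [FiniteDimensional K F] (D : W →ₗ[K] V) (hD : ∀ w, D w ∈ M → w = 0)
    (hle : LinearMap.range D ≤ M ⊔ F) : Module.finrank K W ≤ Module.finrank K F := by
  have hinj : Function.Injective (M.mkQ ∘ₗ D) := by
    rw [← LinearMap.ker_eq_bot, LinearMap.ker_eq_bot']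
    intro w hw
    exact hD w ((Submodule.Quotient.mk_eq_zero M).1 hw)
  have hrange : LinearMap.range (M.mkQ ∘ₗ D) ≤ F.map M.mkQ := by
    rintro _ ⟨w, rfl⟩
    obtain ⟨x, hx, y, hy, hxy⟩ := Submodule.mem_sup.1 (hle ⟨w, rfl⟩)
    refine ⟨y, hy, ?_⟩
    rw [LinearMap.comp_apply, ← hxy, map_add, (M.mkQ_apply x).trans
      ((Submodule.Quotient.mk_eq_zero M).2 hx), zero_add]
  calc Module.finrank K W = Module.finrank K (LinearMap.range (M.mkQ ∘ₗ D)) :=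
        (LinearMap.finrank_range_of_inj hinj).symm
    _ ≤ Module.finrank K (F.map M.mkQ) := Submodule.finrank_mono hrange
    _ ≤ Module.finrank K F := Submodule.finrank_map_le _ _

/-- A subspace of finite codimension that contains its preimage under an endomorphism is invariant
under that endomorphism. -/
theorem Submodule.le_comap_of_comap_le {M : Submodule K V} [FiniteDimensional K (V ⧸ M)]
    (f : V →ₗ[K] V) (h : M.comap f ≤ M) : M ≤ M.comap f := by
  -- `f` induces an injection `V/f⁻¹M → V/M`, while `h` gives a surjection between the same spaces.
  -- In finite dimension the surjection is then injective, which is the claim.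
  have hinj : Function.Injective ((M.comap f).mapQ M f le_rfl) := by
    rw [← LinearMap.ker_eq_bot, Submodule.ker_mapQ, Submodule.mkQ_map_self]
  have hfin : FiniteDimensional K (V ⧸ M.comap f) := Module.Finite.of_injective _ hinj
  have hsurj : Function.Surjective (Submodule.factor h) := Submodule.factor_surjective h
  have heq : Module.finrank K (V ⧸ M.comap f) = Module.finrank K (V ⧸ M) :=
    le_antisymm (LinearMap.finrank_le_finrank_of_injective hinj)
      (LinearMap.finrank_le_finrank_of_surjective hsurj)
  have hinj' := (LinearMap.injective_iff_surjective_of_finrank_eq_finrank heq).2 hsurj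
  intro x hx
  refine (Submodule.Quotient.mk_eq_zero _).1 (hinj' ?_)
  rw [map_zero]
  exact (Submodule.Quotient.mk_eq_zero M).2 hx

end LinearAlgebra

/-! ### Defect, codimension and dimension of `M = F₀ K_Θ` -/

namespace Hardy

variable {m r s : ℕ}

/-- Since `S*S = 1` and `SF` vanishes at `0`, near invariance contains the inclusion `S⁻¹M ⊆ M`. -/
theorem IsNearlyInvariant.map_shift_le {M : Submodule ℂ (Hardy m)} (hM : IsNearlyInvariant M)
    (hfin : FiniteDimensional ℂ (Hardy m ⧸ M)) :
    M.map (shift m : Hardy m →ₗ[ℂ] Hardy m) ≤ M := by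
  refine Submodule.map_le_iff_le_comap.2 (Submodule.le_comap_of_comap_le _ fun F hF => ?_)
  have h := hM.2 (shift m F) hF (by rw [eval_zero_point, shift_apply_zero])
  rwa [backwardShift_shift] at h

/-- Multiplication by an injective matrix function on a space `K`, as a linear map. -/
theorem EqMatrixMul.exists_linearMap {M : Submodule ℂ (Hardy m)}
    {A : ℂ → Matrix (Fin m) (Fin r) ℂ} {K : Submodule ℂ (Hardy r)} (h : EqMatrixMul M A K) :
    ∃ Φ : K →ₗ[ℂ] Hardy m, LinearMap.range Φ = M ∧
      ∀ G : K, ∀ z ∈ ball (0 : ℂ) 1, (eval (Φ G) z).ofLp = A z *ᵥ (eval (G : Hardy r) z).ofLp := by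
  choose f hfM hf using h.1
  refine ⟨{ toFun := fun G => f G G.2, map_add' := fun F G => ?_, map_smul' := fun c F => ?_ },
    le_antisymm ?_ ?_, fun G => hf G G.2⟩
  · refine eval_ext fun z hz => WithLp.ofLp_injective 2 ?_
    rw [hf _ _ z hz, eval_add _ _ hz, WithLp.ofLp_add, hf _ _ z hz, hf _ _ z hz, ← Matrix.mulVec_add,
      Submodule.coe_add, eval_add _ _ hz, WithLp.ofLp_add]
  · refine eval_ext fun z hz => WithLp.ofLp_injective 2 ?_
    rw [hf _ _ z hz, RingHom.id_apply, eval_smul _ _ hz, WithLp.ofLp_smul, hf _ _ z hz,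
      ← Matrix.mulVec_smul, Submodule.coe_smul, eval_smul _ _ hz, WithLp.ofLp_smul]
  · rintro _ ⟨G, rfl⟩
    exact hfM G G.2
  · intro F hF
    obtain ⟨G, hG, hFG⟩ := h.2 F hF
    exact ⟨⟨G, hG⟩, eval_ext fun z hz => WithLp.ofLp_injective 2
      ((hf G hG z hz).trans (hFG z hz).symm)⟩

variable {M : Submodule ℂ (Hardy m)} {A : ℂ → Matrix (Fin m) (Fin r) ℂ}
  {Θ : ℂ → EuclideanSpace ℂ (Fin s) →L[ℂ] EuclideanSpace ℂ (Fin r)}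

theorem mem_modelSpace_iff {T : Hardy s →ₗᵢ[ℂ] Hardy r}
    (hT : ∀ G, ∀ z ∈ ball (0 : ℂ) 1, eval (T G) z = Θ z (eval G z)) {G : Hardy r} :
    G ∈ modelSpace Θ ↔ ∀ H, inner ℂ G (T H) = 0 := by
  rw [modelSpace, multiplierRange_eq_range hT, Submodule.mem_orthogonal']
  exact ⟨fun h H => h _ ⟨H, rfl⟩, by rintro h _ ⟨H, rfl⟩; exact h H⟩

/-- The linear map `c ↦ F₀ Θ c` onto the minimal defect space of `M = F₀ K_Θ`. -/
theorem exists_defect_linearMap (hA : ContinuousAt A 0) (hinj : ∀ v, A 0 *ᵥ v = 0 → v = 0)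
    (hΘ : IsInnerMultiplier Θ) (hΘ0 : Θ 0 = 0) (h : EqMatrixMul M A (modelSpace Θ)) :
    ∃ D : EuclideanSpace ℂ (Fin s) →ₗ[ℂ] Hardy m, (∀ c, D c ∈ M → c = 0) ∧
      LinearMap.range D ≤ M.map (shift m : Hardy m →ₗ[ℂ] Hardy m) ∧
      M.map (shift m : Hardy m →ₗ[ℂ] Hardy m) ≤ M ⊔ LinearMap.range D := by
  obtain ⟨T, hT⟩ := exists_multiplier_isometry hΘ.isometry
  have hTS := map_shift_of_eval_eq hT
  have hK := @mem_modelSpace_iff r s Θ T hT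
  obtain ⟨Φ, hΦM, hΦ⟩ := h.exists_linearMap
  set C := constant s
  have hC0 : ∀ c, T (C c) 0 = 0 := fun c => by
    rw [← eval_zero_point, hT _ _ (mem_ball_self one_pos), hΘ0]; rfl
  have hCS : ∀ c F, inner ℂ (C c) (shift s F) = 0 := fun c F => by
    rw [inner_constant_left, shift_apply_zero, inner_zero_right]
  -- `⟨S*Tc, TH⟩ = ⟨Tc, TSH⟩ = ⟨c, SH⟩ = 0`.
  have hBK : ∀ c, backwardShift r (T (C c)) ∈ modelSpace Θ := fun c => hK.2 fun H => by
    rw [backwardShift, ContinuousLinearMap.adjoint_inner_left, ← hTS, T.inner_map_map, hCS]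
  let E : EuclideanSpace ℂ (Fin s) →ₗ[ℂ] modelSpace Θ :=
    ((backwardShift r : Hardy r →ₗ[ℂ] Hardy r) ∘ₗ T.toLinearMap ∘ₗ C).codRestrict _ hBK
  let D : EuclideanSpace ℂ (Fin s) →ₗ[ℂ] Hardy m := (shift m : Hardy m →ₗ[ℂ] Hardy m) ∘ₗ Φ ∘ₗ E
  have hD : ∀ c, ∀ z ∈ ball (0 : ℂ) 1, (eval (D c) z).ofLp = A z *ᵥ (eval (T (C c)) z).ofLp := by
    intro c z hz
    change (eval (shift m (Φ (E c))) z).ofLp = _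
    rw [eval_shift _ hz, WithLp.ofLp_smul, hΦ _ z hz, ← Matrix.mulVec_smul, ← WithLp.ofLp_smul,
      ← eval_shift _ hz]
    exact congrArg (fun F => A z *ᵥ (eval F z).ofLp)
      (shift_backwardShift_of_apply_zero (hC0 c))
  refine ⟨D, fun c hc => ?_, ?_, ?_⟩
  · rw [← hΦM] at hc
    obtain ⟨G, hG⟩ := hc
    -- Cancelling `F₀` puts `Θc` in `K_Θ` as well as in `ΘH²`, so it is zero.
    have h1 : T (C c) - G = 0 := eq_zero_of_mulVec_eval_eq_zero hA hinj fun z hz => by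
      rw [eval_sub _ _ hz, WithLp.ofLp_sub, Matrix.mulVec_sub, ← hD c z hz, ← hΦ G z hz, hG,
        sub_self]
    have h2 : inner ℂ (T (C c)) (T (C c)) = 0 := by
      conv_lhs => rw [sub_eq_zero.1 h1]
      rw [← sub_eq_zero.1 h1]
      exact hK.1 (sub_eq_zero.1 h1 ▸ G.2) _
    rw [T.inner_map_map, inner_self_eq_zero] at h2
    rw [← constant_apply_zero c, h2]
    rfl
  · rintro _ ⟨c, rfl⟩
    exact ⟨Φ (E c), hΦM ▸ ⟨_, rfl⟩, rfl⟩
  · rintro _ ⟨F, hF, rfl⟩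
    rw [SetLike.mem_coe, ← hΦM] at hF
    obtain ⟨G, rfl⟩ := hF
    -- `T u` is the projection of `SG` onto `ΘH²`. For every `H`, `⟨u, SH⟩ = ⟨SG, STH⟩ = ⟨G, TH⟩ =
    -- 0`, so `S*u = 0` and `u` is constant.
    set u := ContinuousLinearMap.adjoint T.toContinuousLinearMap (shift r (G : Hardy r)) with hu
    have huT : ∀ H, inner ℂ u H = inner ℂ (shift r (G : Hardy r)) (T H) := fun H =>
      ContinuousLinearMap.adjoint_inner_left _ _ _
    have hBu : backwardShift s u = 0 := by
      refine inner_self_eq_zero (𝕜 := ℂ).1 ?_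
      nth_rewrite 1 [backwardShift]
      rw [ContinuousLinearMap.adjoint_inner_left, huT, hTS, inner_shift_shift, hK.1 G.2]
    have huC : C (u 0) = u := constant_of_backwardShift_eq_zero hBu
    have hg : shift r (G : Hardy r) - T u ∈ modelSpace Θ := hK.2 fun H => by
      rw [inner_sub_left, T.inner_map_map, huT, sub_self]
    refine Submodule.mem_sup.2 ⟨Φ ⟨_, hg⟩, hΦM ▸ ⟨_, rfl⟩, D (u 0), ⟨_, rfl⟩, ?_⟩
    refine eval_ext fun z hz => WithLp.ofLp_injective 2 ?_
    change _ = (eval (shift m (Φ G)) z).ofLp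
    rw [eval_add _ _ hz, WithLp.ofLp_add, hΦ _ z hz, hD _ z hz, huC, ← Matrix.mulVec_add,
      ← WithLp.ofLp_add, ← eval_add _ _ hz, sub_add_cancel, eval_shift _ hz, eval_shift _ hz,
      WithLp.ofLp_smul, WithLp.ofLp_smul, hΦ _ z hz, Matrix.mulVec_smul]

theorem hasDefect_of_eqMatrixMul (hA : ContinuousAt A 0) (hinj : ∀ v, A 0 *ᵥ v = 0 → v = 0)
    (hΘ : IsInnerMultiplier Θ) (hΘ0 : Θ 0 = 0) (h : EqMatrixMul M A (modelSpace Θ)) :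
    HasDefect (shift m) M s := by
  obtain ⟨D, hDM, hDS, hSD⟩ := exists_defect_linearMap hA hinj hΘ hΘ0 h
  have hD : Function.Injective D := by
    rw [← LinearMap.ker_eq_bot, LinearMap.ker_eq_bot']
    exact fun c hc => hDM c (hc ▸ M.zero_mem)
  refine ⟨⟨LinearMap.range D, ⟨inferInstance, hSD⟩, ?_⟩, ?_⟩
  · rw [LinearMap.finrank_range_of_inj hD, finrank_euclideanSpace_fin]
  · rintro _ ⟨F, ⟨hF, hle⟩, rfl⟩
    have := finrank_le_of_injective_of_le_sup D hDM (hDS.trans hle)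
    rwa [finrank_euclideanSpace_fin] at this

/-- Finite codimension would make `M` invariant for `S`, so that `⊥` would be a defect space. -/
theorem IsNearlyInvariant.not_finiteDimensional_quotient (hM : IsNearlyInvariant M) {d : ℕ}
    (hd : HasDefect (shift m) M d) (hd0 : d ≠ 0) : ¬ FiniteDimensional ℂ (Hardy m ⧸ M) := by
  intro hfin
  refine hd0 (Nat.le_zero.1 (hd.2 ⟨⊥, ⟨inferInstance, ?_⟩, finrank_bot ℂ _⟩))
  exact (hM.map_shift_le hfin).trans le_sup_left

theorem finiteDimensional_modelSpace (hA : ContinuousAt A 0) (hinj : ∀ v, A 0 *ᵥ v = 0 → v = 0)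
    (h : EqMatrixMul M A (modelSpace Θ)) (hfin : FiniteDimensional ℂ M) :
    FiniteDimensional ℂ (modelSpace Θ) := by
  obtain ⟨Φ, hΦM, hΦ⟩ := h.exists_linearMap
  have hΦinj : Function.Injective Φ := by
    rw [← LinearMap.ker_eq_bot, LinearMap.ker_eq_bot']
    intro G hG
    refine Subtype.ext (eq_zero_of_mulVec_eval_eq_zero hA hinj fun z hz => ?_)
    rw [← hΦ G z hz, hG, eval_zero_function]
    rfl
  subst hΦM
  exact Module.Finite.equiv (LinearEquiv.ofInjective Φ hΦinj).symm

end Hardy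

theorem IsFiniteBlaschkeProduct.congr {θ φ : ℂ → ℂ} (h : IsFiniteBlaschkeProduct θ)
    (hφ : ∀ z ∈ ball (0 : ℂ) 1, φ z = θ z) : IsFiniteBlaschkeProduct φ := by
  obtain ⟨c, n, a, hc, ha, hprod⟩ := h
  exact ⟨c, n, a, hc, ha, fun z hz => (hφ z hz).trans (hprod z hz)⟩

/-! ### Diagonal multipliers and their scalar entries -/

namespace Hardy

variable {m r s : ℕ}

theorem memlp_map (L : EuclideanSpace ℂ (Fin s) →L[ℂ] EuclideanSpace ℂ (Fin r)) (F : Hardy s) :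
    Memℓp (fun n => L (F n)) 2 := by
  have h := (lp.hasSum_norm (p := 2) (by norm_num) F).summable
  refine memℓp_gen ((h.mul_left (‖L‖ ^ (2 : ENNReal).toReal)).of_nonneg_of_le
    (fun n => by positivity) fun n => ?_)
  rw [← Real.mul_rpow (norm_nonneg _) (norm_nonneg _)]
  exact Real.rpow_le_rpow (norm_nonneg _) (L.le_opNorm _) (by norm_num)

/-- A linear map applied to every Taylor coefficient. -/
noncomputable def mapCoeff (L : EuclideanSpace ℂ (Fin s) →L[ℂ] EuclideanSpace ℂ (Fin r)) :
    Hardy s →ₗ[ℂ] Hardy r where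
  toFun F := ⟨fun n => L (F n), memlp_map L F⟩
  map_add' F G := by
    ext1
    funext n
    exact L.map_add (F n) (G n)
  map_smul' c F := by
    ext1
    funext n
    exact L.map_smul c (F n)

theorem eval_mapCoeff (L : EuclideanSpace ℂ (Fin s) →L[ℂ] EuclideanSpace ℂ (Fin r))
    (F : Hardy s) {z : ℂ} (hz : z ∈ ball (0 : ℂ) 1) : eval (mapCoeff L F) z = L (eval F z) := by
  unfold eval
  rw [L.map_tsum (summable_eval F hz)]
  exact tsum_congr fun n => (L.map_smul _ _).symm

theorem inner_mapCoeff {L : EuclideanSpace ℂ (Fin s) →L[ℂ] EuclideanSpace ℂ (Fin r)}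
    {L' : EuclideanSpace ℂ (Fin r) →L[ℂ] EuclideanSpace ℂ (Fin s)}
    (h : ∀ v w, inner ℂ (L v) w = inner ℂ v (L' w)) (F : Hardy s) (G : Hardy r) :
    inner ℂ (mapCoeff L F) G = inner ℂ F (mapCoeff L' G) := by
  have h₁ := lp.hasSum_inner (𝕜 := ℂ) (mapCoeff L F) G
  have h₂ := lp.hasSum_inner (𝕜 := ℂ) F (mapCoeff L' G)
  have hcoeff : (fun n => inner ℂ (mapCoeff L F n) (G n)) =
      fun n => inner ℂ (F n) (mapCoeff L' G n) := funext fun n => h (F n) (G n)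
  rw [hcoeff] at h₁
  exact h₁.unique h₂

/-- The inclusion of `ℂ` into `ℂʳ` as the `j`-th coordinate axis. -/
noncomputable def axis (j : Fin r) : EuclideanSpace ℂ (Fin 1) →L[ℂ] EuclideanSpace ℂ (Fin r) :=
  (EuclideanSpace.proj 0).smulRight (EuclideanSpace.single j 1)

/-- The projection of `ℂʳ` onto the `j`-th coordinate. -/
noncomputable def coord (j : Fin r) : EuclideanSpace ℂ (Fin r) →L[ℂ] EuclideanSpace ℂ (Fin 1) :=
  (EuclideanSpace.proj j).smulRight (EuclideanSpace.single 0 1)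

theorem axis_apply (j : Fin r) (v : EuclideanSpace ℂ (Fin 1)) :
    axis j v = v 0 • EuclideanSpace.single j 1 := rfl

theorem coord_apply (j : Fin r) (w : EuclideanSpace ℂ (Fin r)) :
    coord j w = w j • EuclideanSpace.single 0 1 := rfl

theorem coord_axis (j : Fin r) (v : EuclideanSpace ℂ (Fin 1)) : coord j (axis j v) = v := by
  ext i
  rw [Subsingleton.elim i 0]
  simp [coord_apply, axis_apply]

theorem inner_axis (j : Fin r) (v : EuclideanSpace ℂ (Fin 1)) (w : EuclideanSpace ℂ (Fin r)) :
    inner ℂ (axis j v) w = inner ℂ v (coord j w) := by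
  rw [axis_apply, coord_apply, inner_smul_left, inner_smul_right, EuclideanSpace.inner_single_left,
    EuclideanSpace.inner_single_right]
  simp [mul_comm]

/-- `coord j` is both the adjoint and a left inverse of `axis j`. -/
theorem norm_mapCoeff_axis (j : Fin r) (F : Hardy 1) : ‖mapCoeff (axis j) F‖ = ‖F‖ := by
  have h : mapCoeff (coord j) (mapCoeff (axis j) F) = F := by
    ext1
    funext n
    exact coord_axis j (F n)
  rw [@norm_eq_sqrt_re_inner ℂ, inner_mapCoeff (inner_axis j), h, ← @norm_eq_sqrt_re_inner ℂ]

section Diagonal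

variable {Θ : ℂ → EuclideanSpace ℂ (Fin r) →L[ℂ] EuclideanSpace ℂ (Fin r)} {θ : Fin r → ℂ → ℂ}

theorem coord_diagonal (d : Fin r → ℂ) (j : Fin r) (w : EuclideanSpace ℂ (Fin r)) :
    coord j (Matrix.toEuclideanCLM (𝕜 := ℂ) (Matrix.diagonal d) w) = d j • coord j w := by
  rw [coord_apply, coord_apply, smul_smul, Matrix.ofLp_toEuclideanCLM, Matrix.mulVec_diagonal]

theorem diagonal_axis (d : Fin r → ℂ) (j : Fin r) (v : EuclideanSpace ℂ (Fin 1)) :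
    Matrix.toEuclideanCLM (𝕜 := ℂ) (Matrix.diagonal d) (axis j v) = axis j (d j • v) := by
  ext i
  rw [Matrix.ofLp_toEuclideanCLM, Matrix.mulVec_diagonal, axis_apply, axis_apply]
  rcases eq_or_ne i j with rfl | hij <;> simp [*]

/-- If the model space of a diagonal inner multiplier has finite dimension, then its entries are
finite Blaschke products. -/
theorem isFiniteBlaschkeProduct_of_finiteDimensional (hΘ : IsInnerMultiplier Θ)
    (hdiag : ∀ z ∈ ball (0 : ℂ) 1,
      Θ z = Matrix.toEuclideanCLM (𝕜 := ℂ) (Matrix.diagonal fun i => θ i z))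
    (hfin : FiniteDimensional ℂ (modelSpace Θ)) (j : Fin r) : IsFiniteBlaschkeProduct (θ j) := by
  obtain ⟨T, hT⟩ := exists_multiplier_isometry hΘ.isometry
  have hcoord : ∀ H, ∀ z ∈ ball (0 : ℂ) 1,
      eval (mapCoeff (coord j) (T H)) z = θ j z • eval (mapCoeff (coord j) H) z := by
    intro H z hz
    rw [eval_mapCoeff _ _ hz, hT _ z hz, hdiag z hz, coord_diagonal, eval_mapCoeff _ _ hz]
  -- Multiplication by `θ_j` inherits isometry from `Θ`, which acts on the `j`-th axis as `θ_j`.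
  obtain ⟨t, ht⟩ := exists_multiplier_isometry (s := 1) (r := 1) (Θ := fun z => θ j z • 1) <| by
    intro G
    set f := mapCoeff (coord j) (T (mapCoeff (axis j) G)) with hf
    have heval : ∀ z ∈ ball (0 : ℂ) 1, eval f z = θ j z • eval G z := fun z hz => by
      rw [hf, hcoord _ z hz, eval_mapCoeff _ _ hz, eval_mapCoeff _ _ hz, coord_axis]
    have hfT : mapCoeff (axis j) f = T (mapCoeff (axis j) G) := eval_ext fun z hz => by
      rw [eval_mapCoeff _ _ hz, heval z hz, hT _ z hz, hdiag z hz, eval_mapCoeff _ _ hz,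
        diagonal_axis]
    exact ⟨f, heval, by rw [← norm_mapCoeff_axis j, hfT, T.norm_map, norm_mapCoeff_axis]⟩
  have ht' : ∀ G, ∀ z ∈ ball (0 : ℂ) 1, eval (t G) z = θ j z • eval G z := ht
  -- The cokernel of `t` embeds in `K_Θ` along the `j`-th axis and so inherits finite dimension.
  have hmem : ∀ x ∈ (LinearMap.range t.toLinearMap)ᗮ, mapCoeff (axis j) x ∈ modelSpace Θ := by
    intro x hx
    rw [mem_modelSpace_iff hT]
    intro H
    have h : mapCoeff (coord j) (T H) = t (mapCoeff (coord j) H) := eval_ext fun z hz => by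
      rw [hcoord H z hz, ht' _ z hz]
    rw [inner_mapCoeff (inner_axis j), h]
    exact (Submodule.mem_orthogonal' _ _).1 hx _ ⟨_, rfl⟩
  have hinj : Function.Injective ((mapCoeff (axis j)).restrict hmem) := by
    rw [← LinearMap.ker_eq_bot, LinearMap.ker_eq_bot']
    intro x hx
    refine Subtype.ext (norm_eq_zero.1 ?_)
    rw [← norm_mapCoeff_axis j]
    exact norm_eq_zero.2 (congrArg Subtype.val hx)
  refine (exists_blaschke_of_finiteDimensional t (map_shift_of_eval_eq ht)
    (Module.Finite.of_injective _ hinj)).congr fun z hz => ?_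
  -- The constant function `1` evaluates to `1`, so `t` sends it to `θ_j`.
  rw [ht' _ z hz, eval_eq_add_smul_eval_backwardShift _ hz]
  have h : backwardShift 1 (constant 1 (EuclideanSpace.single 0 1)) = 0 := by
    ext1
    funext n
    rw [backwardShift_apply, constant_apply_succ]
    rfl
  simp [h]

end Diagonal

end Hardy

theorem mainTheorem5 {m r : ℕ} (M : Submodule ℂ (Hardy m)) (hM : M ≠ ⊥)
    (hnear : Hardy.IsNearlyInvariant M)
    (W : OrthonormalBasis (Fin r) ℂ (Hardy.wandering M)) :
    (∀ (r' : ℕ) (Θ : ℂ → EuclideanSpace ℂ (Fin r') →L[ℂ] EuclideanSpace ℂ (Fin r)),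
      Hardy.IsInnerMultiplier Θ → Θ 0 = 0 →
      Hardy.EqMatrixMul M (Hardy.columnMatrix fun j => (W j : Hardy m)) (Hardy.modelSpace Θ) →
      IsAlmostInvariant (Hardy.shift m) M ∧ HasDefect (Hardy.shift m) M r') ∧
    (∀ (Θ : ℂ → EuclideanSpace ℂ (Fin r) →L[ℂ] EuclideanSpace ℂ (Fin r)) (θ : Fin r → ℂ → ℂ),
      Hardy.IsInnerMultiplier Θ → Θ 0 = 0 →
      Hardy.EqMatrixMul M (Hardy.columnMatrix fun j => (W j : Hardy m)) (Hardy.modelSpace Θ) →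
      (∀ i, IsInnerFunction (θ i)) →
      (∀ z ∈ Metric.ball (0 : ℂ) 1,
        Θ z = Matrix.toEuclideanCLM (𝕜 := ℂ) (Matrix.diagonal fun i => θ i z)) →
      (∃ j, ¬ IsFiniteBlaschkeProduct (θ j)) →
      IsAlmostInvariant (Hardy.shift m) M ∧ IsHalfSpace M ∧ HasDefect (Hardy.shift m) M r) := by
  have hA := Hardy.continuousAt_columnMatrix fun j => (W j : Hardy m)
  have hinj := Hardy.columnMatrix_zero_injective W
  have part₁ : ∀ (r' : ℕ) (Θ : ℂ → EuclideanSpace ℂ (Fin r') →L[ℂ] EuclideanSpace ℂ (Fin r)),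
      Hardy.IsInnerMultiplier Θ → Θ 0 = 0 →
      Hardy.EqMatrixMul M (Hardy.columnMatrix fun j => (W j : Hardy m)) (Hardy.modelSpace Θ) →
      IsAlmostInvariant (Hardy.shift m) M ∧ HasDefect (Hardy.shift m) M r' := by
    intro r' Θ hΘ hΘ0 h
    have hd := Hardy.hasDefect_of_eqMatrixMul hA hinj hΘ hΘ0 h
    obtain ⟨F, hF, -⟩ := hd.1
    exact ⟨⟨hnear.1, F, hF⟩, hd⟩
  refine ⟨part₁, ?_⟩
  rintro Θ θ hΘ hΘ0 h - hdiag ⟨j, hj⟩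
  obtain ⟨hai, hd⟩ := part₁ r Θ hΘ hΘ0 h
  refine ⟨hai, ⟨fun hfin => hj ?_, ?_⟩, hd⟩
  · exact Hardy.isFiniteBlaschkeProduct_of_finiteDimensional hΘ hdiag
      (Hardy.finiteDimensional_modelSpace hA hinj h hfin) j
  -- The existence of an index `j : Fin r` makes the defect `r` nonzero.
  · exact hnear.not_finiteDimensional_quotient hd j.pos.ne'
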